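/- A strict partition is a finite strictly decreasing sequence $\lambda=(\lambda_1>\dots>\lambda_l)$ of positive integers (possibly empty), with length $\ell(\lambda)=l$ and size $|\lambda|=\sum_i\lambda_i$; let $\mathcal{SP}_N$ be the set of strict partitions of size $N$. The shifted Young diagram of $\lambda$ is $S(\lambda)=\{(i,j)\in\mathbb Z^2 : 1\le i\le \ell(\lambda),\ i\le j\le \lambda_i+i-1\}$. If $S(\mu)\subset S(\lambda)$ and $k=|\lambda|-|\mu|$, let $g^{\lambda/\mu}$ be the number of sequences $(\lambda^{(0)},\dots,\lambda^{(k)})$ of strict partitions with $\lambda^{(0)}=\mu$, $\lambda^{(k)}=\lambda$ such that each $S(\lambda^{(i)})$ is obtained from $S(\lambda^{(i-1)})$ by adding exactly one box; otherwise let $g^{\lambda/\mu}=0$. Put $g^\lambda=g^{\lambda/\emptyset}$. For a strict partition $\mu$ of size $m$, an integer $n\ge 0$, and a function $\varphi$ on strict partitions, set $$\mathbb E_{\mu,n}[\varphi]=\sum_{\lambda\in\mathcal{SP}_{n+m}}\frac{m!}{(n+m)!}\,2^{\,n-\ell(\lambda)+\ell(\mu)}\,\frac{g^\lambda}{g^\mu}\,g^{\lambda/\mu}\,\varphi(\lambda).$$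 Let $\widehat p_1(\lambda)=\sum_{\square\in S(\lambda)}\tfrac12 c_\square(c_\square+1)$, where $c_\square=j-i$ for $\square=(i,j)$. Then for every strict partition $\mu$ and every integer $n\ge 0$, $$\mathbb E_{\mu,n}\big[\widehat p_1-\widehat p_1(\mu)\big]=\frac{n(n-1)}{2}+n|\mu|.$$ -/

import Mathlib

/-- A strict partition: a finite strictly decreasing sequence of positive integers. -/
@[ext]
structure StrictPartition where
  parts : List ℕ
  decreasing : parts.Pairwise (fun a b => b < a)
  pos : ∀ a ∈ parts, 0 < a

namespace StrictPartition

/-- The empty partition. -/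
def empty : StrictPartition := ⟨[], by simp, by simp⟩

/-- The length `ℓ(lam)`. -/
def length (lam : StrictPartition) : ℕ := lam.parts.length

/-- The size `|lam|`. -/
def size (lam : StrictPartition) : ℕ := lam.parts.sum

/-- The `i`-th part, `i = 1, 2, …, ℓ(lam)` (and `0` for `i > ℓ(lam)`). -/
def part (lam : StrictPartition) (i : ℕ) : ℕ := lam.parts.getD (i - 1) 0

theorem finite_size_eq (n : ℕ) : {lam : StrictPartition | lam.size = n}.Finite := by
  have hinj : Set.InjOn (fun lam : StrictPartition => (lam.parts : Multiset ℕ).toFinset)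
      {lam : StrictPartition | lam.size = n} := by
    intro a _ b _ hab
    have ha : a.parts.Nodup := a.decreasing.imp (fun h => (ne_of_lt h).symm)
    have hb : b.parts.Nodup := b.decreasing.imp (fun h => (ne_of_lt h).symm)
    have hp : a.parts.Perm b.parts := by
      rw [List.perm_ext_iff_of_nodup ha hb]
      intro x
      have := congrArg (fun s : Finset ℕ => x ∈ s) hab
      simpa using this
    refine StrictPartition.ext (hp.eq_of_pairwise ?_ a.decreasing b.decreasing)
    intro x y _ _ h1 h2
    exact absurd h1 (not_lt.mpr h2.le)
  refine Set.Finite.of_finite_image (f := fun lam : StrictPartition =>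
    (lam.parts : Multiset ℕ).toFinset) ?_ hinj
  refine Set.Finite.subset (Finset.finite_toSet (Finset.range (n + 1)).powerset) ?_
  rintro _ ⟨lam, hl, rfl⟩
  simp only [Finset.coe_powerset, Set.mem_preimage, Set.mem_powerset_iff]
  intro x hx
  have hx' : x ∈ lam.parts := by simpa using hx
  have h1 : x ≤ lam.parts.sum := List.single_le_sum (by simp) x hx'
  have h2 : lam.parts.sum = n := hl
  simp
  omega

/-- The finite set of all strict partitions of `n`. -/
noncomputable def ofSize (n : ℕ) : Finset StrictPartition := (finite_size_eq n).toFinset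

theorem mem_ofSize {n : ℕ} {lam : StrictPartition} : lam ∈ ofSize n ↔ lam.size = n := by
  simp [ofSize]

/-- The shifted Young diagram
`S(lam) = {(i, j) | 1 ≤ i ≤ ℓ(lam), i ≤ j ≤ lam_i + i - 1}`. -/
def diagram (lam : StrictPartition) : Finset (ℕ × ℕ) :=
  (Finset.Icc 1 lam.length).biUnion fun i =>
    (Finset.Icc i (lam.part i + i - 1)).image fun j => (i, j)

theorem mem_diagram {lam : StrictPartition} {i j : ℕ} :
    (i, j) ∈ lam.diagram ↔
      (1 ≤ i ∧ i ≤ lam.length) ∧ i ≤ j ∧ j ≤ lam.part i + i - 1 := by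
  simp only [diagram, Finset.mem_biUnion, Finset.mem_image, Finset.mem_Icc, Prod.mk.injEq]
  constructor
  · rintro ⟨a, ha, b, hb, rfl, rfl⟩
    exact ⟨ha, hb⟩
  · rintro ⟨ha, hb⟩
    exact ⟨i, ha, j, hb, rfl, rfl⟩

/-- `lam` is obtained from `mu` by adding exactly one box to the shifted diagram. -/
def AddsOneBox (mu lam : StrictPartition) : Prop :=
  ∃ b : ℕ × ℕ, b ∉ mu.diagram ∧ lam.diagram = insert b mu.diagram

/-- The standard tableaux of shape `S(lam/mu)`: sequences `(T 0, …, T k)` of strict partitions,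
`k = |lam| - |mu|`, from `mu` to `lam`, adding exactly one box at each step. Meant for
`S(mu) ⊆ S(lam)`. -/
def standardTableaux (mu lam : StrictPartition) :
    Set (Fin (lam.size - mu.size + 1) → StrictPartition) :=
  {T | T 0 = mu ∧ T (Fin.last _) = lam ∧
    ∀ i : Fin (lam.size - mu.size), AddsOneBox (T i.castSucc) (T i.succ)}

/-- `g^{lam/mu}`: the number of standard tableaux of shape `S(lam/mu)`, and `0` unless
`S(mu) ⊆ S(lam)`. -/
noncomputable def skewG (lam mu : StrictPartition) : ℕ :=
  if mu.diagram ⊆ lam.diagram then (standardTableaux mu lam).ncard else 0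

/-- `g^lam = g^{lam/∅}`. -/
noncomputable def g (lam : StrictPartition) : ℕ := skewG lam empty

/-- The weight `P_{mu,n}(lam)`, for `lam` a strict partition of `n + |mu|`. -/
noncomputable def prob (mu : StrictPartition) (n : ℕ) (lam : StrictPartition) : ℚ :=
  (mu.size.factorial : ℚ) / ((n + mu.size).factorial : ℚ) *
    (2 : ℚ) ^ ((n : ℤ) - (lam.length : ℤ) + (mu.length : ℤ)) *
    ((g lam : ℚ) / (g mu : ℚ)) * (skewG lam mu : ℚ)

/-- The average `E_{mu,n}[φ]` of a function `φ` on strict partitions. -/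
noncomputable def average (mu : StrictPartition) (n : ℕ) (φ : StrictPartition → ℚ) : ℚ :=
  ∑ lam ∈ ofSize (n + mu.size), prob mu n lam * φ lam

/-- The content `c = j - i` of a box `(i, j)`. -/
def content (b : ℕ × ℕ) : ℚ := (b.2 : ℚ) - (b.1 : ℚ)

/-- The quantity `c (c + 1) / 2` attached to a box of content `c`. -/
def hatContent (b : ℕ × ℕ) : ℚ := 1 / 2 * content b * (content b + 1)

/-- The content evaluation of the first power sum: the function on strict partitions whose value
at `lam` is the sum of `c (c + 1) / 2` over the boxes of the shifted diagram of `lam`. -/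
def hatP1 (lam : StrictPartition) : ℚ := ∑ b ∈ lam.diagram, hatContent b

end StrictPartition

/-! Along a chain of box additions the power of 2 splits into one factor `w` per step: 1 for a
diagonal box, which opens a new row, and 2 for any other box. The average is therefore that of a
growth process whose step from λ to Λ has weight w·g^Λ / ((|λ|+1)·g^λ). Two identities, summed over
all Λ obtained from λ by adding a box, suffice: Σ w·g^Λ = (|λ|+1)·g^λ, so total mass stays 1, and Σ
w·(p̂₁(Λ) − p̂₁(λ))·g^Λ = |λ|(|λ|+1)·g^λ, so a step at size |λ| raises the mean by |λ|. Adding |μ| +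
k over k < n gives the formula.

Both weights are increments of sums Σ F(λ_i), with F = `edgeWeight` and F = `contentWeight`. For
such weights the up operator commutes with the unweighted down operator up to a diagonal operator
(`sum_up_sum_down`), whose entries telescope to second differences of F (`sum_up_sub_sum_down`). The
down operator fixes g away from the empty partition, so by induction on size the up operator
multiplies g by a function of the size (`upG_eq_of_diagonal`). -/

namespace StrictPartition

/-! ### Row sequences and sums over the parts -/

/-- The parts indexed from `0`, extended by zeros. -/
def row (lam : StrictPartition) (i : ℕ) : ℕ := lam.parts.getD i 0

theorem row_pos_iff {lam : StrictPartition} {i : ℕ} : 0 < lam.row i ↔ i < lam.length := by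
  unfold row length
  constructor
  · intro h
    by_contra hi
    rw [List.getD_eq_default _ _ (not_lt.mp hi)] at h
    exact lt_irrefl _ h
  · intro h
    rw [List.getD_eq_getElem _ _ h]
    exact lam.pos _ (List.getElem_mem h)

theorem row_eq_zero {lam : StrictPartition} {i : ℕ} (h : lam.length ≤ i) : lam.row i = 0 := by
  have := (row_pos_iff (lam := lam) (i := i)).not.mpr (not_lt.mpr h)
  omega

/-- Truncated subtraction puts strict decrease and the tail of zeros into one inequality; by
`exists_row_eq` it characterises row sequences. -/
theorem row_succ_le (lam : StrictPartition) (i : ℕ) : lam.row (i + 1) ≤ lam.row i - 1 := by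
  by_cases h : i + 1 < lam.length
  · have := List.pairwise_iff_getElem.mp lam.decreasing i (i + 1)
      (by unfold length at h; omega) h (Nat.lt_succ_self i)
    unfold row
    unfold length at h
    rw [List.getD_eq_getElem _ _ h, List.getD_eq_getElem _ _ (by omega)]
    omega
  · rw [row_eq_zero (not_lt.mp h)]
    exact Nat.zero_le _

theorem length_eq_of_row {lam mu : StrictPartition} (h : ∀ i, lam.row i = mu.row i) :
    lam.length = mu.length := by
  have key : ∀ i, i < lam.length ↔ i < mu.length := fun i => by
    rw [← row_pos_iff, ← row_pos_iff, h]
  have h1 := key lam.length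
  have h2 := key mu.length
  omega

theorem ext_row {lam mu : StrictPartition} (h : ∀ i, lam.row i = mu.row i) : lam = mu := by
  refine StrictPartition.ext (List.ext_getElem (length_eq_of_row h) fun i h1 h2 => ?_)
  have := h i
  unfold row at this
  rwa [List.getD_eq_getElem _ _ h1, List.getD_eq_getElem _ _ h2] at this

theorem exists_row_eq (p : ℕ → ℕ) (hp : ∀ i, p (i + 1) ≤ p i - 1) :
    ∃ lam : StrictPartition, ∀ i, lam.row i = p i := by
  -- This forces `p` to vanish by index `p 0`; the parts will be the values before the first zero.
  have hbound : ∀ i, p i ≤ p 0 - i := by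
    intro i
    induction i with
    | zero => simp
    | succ k ih => have := hp k; omega
  have hlt : ∀ i j, i < j → 0 < p j → p j < p i := by
    intro i j hij hj
    induction j, hij using Nat.le_induction with
    | base => have := hp i; simp only [Nat.succ_eq_add_one] at hj ⊢; omega
    | succ k hk ih => have := hp k; have := ih (by omega); omega
  have hex : ∃ n, p n = 0 := ⟨p 0, by have := hbound (p 0); omega⟩
  classical
  have hpos : ∀ i < Nat.find hex, 0 < p i := fun i hi => Nat.pos_of_ne_zero (Nat.find_min hex hi)
  have hzero : ∀ i, Nat.find hex ≤ i → p i = 0 := by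
    intro i hi
    induction i, hi using Nat.le_induction with
    | base => exact Nat.find_spec hex
    | succ k hk ih => have := hp k; omega
  refine ⟨⟨(List.range (Nat.find hex)).map p, ?_, ?_⟩, ?_⟩
  · rw [List.pairwise_iff_getElem]
    intro i j hi hj hij
    simp only [List.length_map, List.length_range] at hi hj
    simp only [List.getElem_map, List.getElem_range]
    exact hlt i j hij (hpos j hj)
  · intro a ha
    simp only [List.mem_map, List.mem_range] at ha
    obtain ⟨i, hi, rfl⟩ := ha
    exact hpos i hi
  · intro i
    unfold row
    by_cases hi : i < Nat.find hex
    · rw [List.getD_eq_getElem _ _ (by simpa using hi)]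
      simp
    · rw [List.getD_eq_default _ _ (by simpa using hi), hzero i (not_lt.mp hi)]

theorem mem_diagram_iff_row {lam : StrictPartition} {i j : ℕ} :
    (i + 1, j) ∈ lam.diagram ↔ i + 1 ≤ j ∧ j < lam.row i + (i + 1) := by
  have hpos := row_pos_iff (lam := lam) (i := i)
  rw [mem_diagram]
  change _ ∧ _ ∧ j ≤ lam.row i + (i + 1) - 1 ↔ _
  omega

theorem zero_notMem_diagram {lam : StrictPartition} {j : ℕ} : (0, j) ∉ lam.diagram := by
  rw [mem_diagram]
  omega

/-- The sum of `F` over the parts. -/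
def partSum (F : ℕ → ℚ) (lam : StrictPartition) : ℚ :=
  ∑ i ∈ Finset.range lam.length, F (lam.row i)

theorem partSum_eq_of_le {F : ℕ → ℚ} (hF : F 0 = 0) {lam : StrictPartition} {N : ℕ}
    (hN : lam.length ≤ N) : partSum F lam = ∑ i ∈ Finset.range N, F (lam.row i) := by
  refine Finset.sum_subset (Finset.range_subset_range.mpr hN) fun i _ hi => ?_
  rw [row_eq_zero (by simpa using hi), hF]

theorem partSum_cast (lam : StrictPartition) : partSum (fun a => (a : ℚ)) lam = lam.size := by
  have h : ∀ l : List ℕ, ∑ i ∈ Finset.range l.length, ((l.getD i 0 : ℕ) : ℚ) = (l.sum : ℕ) := by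
    intro l
    induction l with
    | nil => simp
    | cons a l ih =>
      rw [List.length_cons, Finset.sum_range_succ']
      simp only [List.getD_cons_succ, List.getD_cons_zero, List.sum_cons, Nat.cast_add]
      rw [ih]
      ring
  exact h lam.parts

/-- A row of length `a` has contents `0, …, a - 1` wherever it starts, which makes `hatP1` additive
over the parts. -/
theorem sum_hatContent_row (i a : ℕ) :
    ∑ j ∈ Finset.Icc (i + 1) (a + (i + 1) - 1), hatContent (i + 1, j) =
      ((a : ℚ) - 1) * a * (a + 1) / 6 := by
  induction a with
  | zero => simp
  | succ a ih =>
    have h1 : a + 1 + (i + 1) - 1 = (a + (i + 1) - 1) + 1 := by omega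
    rw [h1, Finset.sum_Icc_succ_top (by omega), ih]
    have h2 : a + (i + 1) - 1 + 1 = a + (i + 1) := by omega
    rw [h2]
    simp only [hatContent, content]
    push_cast
    ring

theorem hatP1_eq_partSum (lam : StrictPartition) :
    hatP1 lam = partSum (fun a => ((a : ℚ) - 1) * a * (a + 1) / 6) lam := by
  unfold hatP1 diagram partSum
  rw [Finset.sum_biUnion]
  · have shift : ∀ G : ℕ → ℚ, ∑ i ∈ Finset.Icc 1 lam.length, G i =
        ∑ i ∈ Finset.range lam.length, G (i + 1) := by
      intro G
      rw [Finset.range_eq_Ico, Finset.sum_Ico_add' G 0 lam.length 1]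
      refine Finset.sum_congr ?_ fun _ _ => rfl
      ext i
      simp only [Finset.mem_Icc, Finset.mem_Ico]
      omega
    rw [shift]
    refine Finset.sum_congr rfl fun i _ => ?_
    rw [Finset.sum_image fun _ _ _ _ h => (Prod.mk.inj h).2]
    exact sum_hatContent_row i (lam.row i)
  · intro a _ b _ hab
    rw [Function.onFun, Finset.disjoint_left]
    intro x hx hy
    simp only [Finset.mem_image] at hx hy
    obtain ⟨_, _, rfl⟩ := hx
    obtain ⟨_, _, h⟩ := hy
    exact hab (congrArg Prod.fst h).symm

/-! ### Adding a box as lengthening a row -/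

/-- `Lam` arises from `lam` by increasing the part with index `i` by one. -/
def StepAt (i : ℕ) (lam Lam : StrictPartition) : Prop :=
  ∀ j, Lam.row j = lam.row j + if j = i then 1 else 0

theorem card_diagram_row (lam : StrictPartition) (i : ℕ) :
    (lam.diagram.filter fun b => b.1 = i + 1).card = lam.row i := by
  have h : (lam.diagram.filter fun b => b.1 = i + 1) =
      (Finset.Ico (i + 1) (lam.row i + (i + 1))).image fun j => (i + 1, j) := by
    ext ⟨a, b⟩
    simp only [Finset.mem_filter, Finset.mem_image, Finset.mem_Ico, Prod.mk.injEq]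
    constructor
    · rintro ⟨h1, rfl⟩
      exact ⟨b, mem_diagram_iff_row.mp h1, rfl, rfl⟩
    · rintro ⟨c, h1, rfl, rfl⟩
      exact ⟨mem_diagram_iff_row.mpr h1, rfl⟩
  rw [h, Finset.card_image_of_injective _ (Prod.mk_right_injective _), Nat.card_Ico]
  omega

/-- Row lengths are the cardinalities of the fibres of the diagram over the first coordinate, so a
new box lengthens exactly one row; conversely the box sits just past the end of that row. -/
theorem addsOneBox_iff {lam Lam : StrictPartition} :
    AddsOneBox lam Lam ↔ ∃ i, StepAt i lam Lam := by
  constructor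
  · rintro ⟨⟨a, b⟩, hb, h⟩
    obtain _ | i := a
    · exact absurd (h ▸ Finset.mem_insert_self _ _ : (0, b) ∈ Lam.diagram) zero_notMem_diagram
    · refine ⟨i, fun j => ?_⟩
      rw [← card_diagram_row, ← card_diagram_row, h, Finset.filter_insert]
      by_cases hj : j = i
      · subst hj
        rw [if_pos rfl, if_pos rfl, Finset.card_insert_of_notMem]
        exact fun hm => hb (Finset.mem_filter.mp hm).1
      · rw [if_neg (by simpa using Ne.symm hj), if_neg hj, add_zero]
  · rintro ⟨i, h⟩
    refine ⟨(i + 1, lam.row i + (i + 1)), ?_, ?_⟩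
    · rw [mem_diagram_iff_row]
      omega
    · ext ⟨a, b⟩
      obtain _ | j := a
      · simp [zero_notMem_diagram]
      · rw [Finset.mem_insert, mem_diagram_iff_row, mem_diagram_iff_row, h j, Prod.mk.injEq]
        split_ifs with hj
        · subst hj
          simp only [true_and]
          omega
        · simp only [add_left_inj, hj, false_and, false_or, add_zero]

theorem AddsOneBox.subset {lam Lam : StrictPartition} (h : AddsOneBox lam Lam) :
    lam.diagram ⊆ Lam.diagram := by
  obtain ⟨b, _, h⟩ := h
  rw [h]
  exact Finset.subset_insert _ _

theorem partSum_stepAt {F : ℕ → ℚ} (hF : F 0 = 0) {i : ℕ} {lam Lam : StrictPartition}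
    (h : StepAt i lam Lam) :
    partSum F Lam - partSum F lam = F (lam.row i + 1) - F (lam.row i) := by
  -- As `F 0 = 0`, both sums may run over a common range containing `i`, even if row `i` was empty.
  let N := max (max lam.length Lam.length) (i + 1)
  rw [partSum_eq_of_le hF (N := N) (by omega), partSum_eq_of_le hF (N := N) (by omega),
    ← Finset.sum_sub_distrib, Finset.sum_eq_single i]
  · rw [h i, if_pos rfl]
  · intro j _ hj
    rw [h j, if_neg hj, add_zero, sub_self]
  · intro hi
    exact absurd (Finset.mem_range.mpr (by omega)) hi

theorem AddsOneBox.size_eq {lam Lam : StrictPartition} (h : AddsOneBox lam Lam) :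
    Lam.size = lam.size + 1 := by
  obtain ⟨i, h⟩ := addsOneBox_iff.mp h
  have := partSum_stepAt (F := fun a => (a : ℚ)) (by simp) h
  rw [partSum_cast, partSum_cast] at this
  have h2 : (Lam.size : ℚ) = (lam.size + 1 : ℕ) := by
    push_cast at this ⊢
    linarith
  exact_mod_cast h2

theorem length_stepAt {i : ℕ} {lam Lam : StrictPartition} (h : StepAt i lam Lam) :
    Lam.length = lam.length + if lam.row i = 0 then 1 else 0 := by
  have key : ∀ j, j < Lam.length ↔ j < lam.length ∨ j = i := fun j => by
    rw [← row_pos_iff, ← row_pos_iff, h j]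
    split_ifs with hj <;> simp [hj]
  have h0 := row_pos_iff (lam := lam) (i := i)
  have h1 := key lam.length
  have h2 := key Lam.length
  have h3 := key i
  have h4 := key (lam.length + 1)
  split_ifs <;> omega


/-! ### Neighbours, unions and intersections -/

open Classical in
/-- The strict partitions obtained by adding a box. -/
noncomputable def up (lam : StrictPartition) : Finset StrictPartition :=
  (ofSize (lam.size + 1)).filter fun Lam => AddsOneBox lam Lam

open Classical in
/-- The strict partitions obtained by removing a box. -/
noncomputable def down (lam : StrictPartition) : Finset StrictPartition :=
  (ofSize (lam.size - 1)).filter fun nu => AddsOneBox nu lam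

theorem mem_up {lam Lam : StrictPartition} : Lam ∈ up lam ↔ AddsOneBox lam Lam := by
  simp only [up, Finset.mem_filter, mem_ofSize, and_iff_right_iff_imp]
  exact AddsOneBox.size_eq

theorem mem_down {lam nu : StrictPartition} : nu ∈ down lam ↔ AddsOneBox nu lam := by
  simp only [down, Finset.mem_filter, mem_ofSize, and_iff_right_iff_imp]
  intro h
  have := h.size_eq
  omega

theorem exists_row_eq_max (lam mu : StrictPartition) :
    ∃ nu : StrictPartition, ∀ i, nu.row i = max (lam.row i) (mu.row i) :=
  exists_row_eq _ fun i => by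
    have := lam.row_succ_le i
    have := mu.row_succ_le i
    omega

/-- The union of the shifted diagrams. -/
noncomputable def sup (lam mu : StrictPartition) : StrictPartition :=
  (exists_row_eq_max lam mu).choose

theorem exists_row_eq_min (lam mu : StrictPartition) :
    ∃ nu : StrictPartition, ∀ i, nu.row i = min (lam.row i) (mu.row i) :=
  exists_row_eq _ fun i => by
    have := lam.row_succ_le i
    have := mu.row_succ_le i
    omega

/-- The intersection of the shifted diagrams. -/
noncomputable def inf (lam mu : StrictPartition) : StrictPartition :=
  (exists_row_eq_min lam mu).choose

theorem row_sup (lam mu : StrictPartition) (i : ℕ) :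
    (sup lam mu).row i = max (lam.row i) (mu.row i) :=
  (exists_row_eq_max lam mu).choose_spec i

theorem row_inf (lam mu : StrictPartition) (i : ℕ) :
    (inf lam mu).row i = min (lam.row i) (mu.row i) :=
  (exists_row_eq_min lam mu).choose_spec i

theorem partSum_sup_add_inf {F : ℕ → ℚ} (hF : F 0 = 0) (lam mu : StrictPartition) :
    partSum F (sup lam mu) + partSum F (inf lam mu) = partSum F lam + partSum F mu := by
  let N := max (max lam.length mu.length) (max (sup lam mu).length (inf lam mu).length)
  rw [partSum_eq_of_le hF (lam := lam) (N := N) (by omega),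
    partSum_eq_of_le hF (lam := mu) (N := N) (by omega),
    partSum_eq_of_le hF (lam := sup lam mu) (N := N) (by omega),
    partSum_eq_of_le hF (lam := inf lam mu) (N := N) (by omega),
    ← Finset.sum_add_distrib, ← Finset.sum_add_distrib]
  refine Finset.sum_congr rfl fun i _ => ?_
  rw [row_sup, row_inf]
  rcases le_total (lam.row i) (mu.row i) with h | h
  · rw [max_eq_right h, min_eq_left h, add_comm]
  · rw [max_eq_left h, min_eq_right h]

/-- The two partitions miss boxes of `Lam` in different rows, so everything can be compared row by
row. -/
theorem of_common_upper {lam rho Lam : StrictPartition} (h1 : AddsOneBox lam Lam)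
    (h2 : AddsOneBox rho Lam) (hne : rho ≠ lam) :
    Lam = sup lam rho ∧ AddsOneBox (inf lam rho) lam ∧ AddsOneBox (inf lam rho) rho := by
  obtain ⟨i, hi⟩ := addsOneBox_iff.mp h1
  obtain ⟨j, hj⟩ := addsOneBox_iff.mp h2
  have hij : i ≠ j := by
    rintro rfl
    exact hne (ext_row fun k => by have := hi k; have := hj k; omega)
  refine ⟨ext_row fun k => ?_, addsOneBox_iff.mpr ⟨j, fun k => ?_⟩,
    addsOneBox_iff.mpr ⟨i, fun k => ?_⟩⟩
  all_goals
    have a := hi k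
    have b := hj k
    simp only [row_sup, row_inf]
    split_ifs at * <;> omega

theorem of_common_lower {lam rho nu : StrictPartition} (h1 : AddsOneBox nu lam)
    (h2 : AddsOneBox nu rho) (hne : rho ≠ lam) :
    nu = inf lam rho ∧ AddsOneBox lam (sup lam rho) ∧ AddsOneBox rho (sup lam rho) := by
  obtain ⟨i, hi⟩ := addsOneBox_iff.mp h1
  obtain ⟨j, hj⟩ := addsOneBox_iff.mp h2
  have hij : i ≠ j := by
    rintro rfl
    exact hne (ext_row fun k => by have := hi k; have := hj k; omega)
  refine ⟨ext_row fun k => ?_, addsOneBox_iff.mpr ⟨j, fun k => ?_⟩,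
    addsOneBox_iff.mpr ⟨i, fun k => ?_⟩⟩
  all_goals
    have a := hi k
    have b := hj k
    simp only [row_sup, row_inf]
    split_ifs at * <;> omega

/-! ### The commutator of the up and down operators -/

/-- The weighted up operator commutes with the down operator up to a diagonal operator. -/
theorem sum_up_sum_down {F : ℕ → ℚ} (hF : F 0 = 0) (G : StrictPartition → ℚ)
    (lam : StrictPartition) :
    ∑ Lam ∈ up lam, (partSum F Lam - partSum F lam) * ∑ rho ∈ down Lam, G rho =
      ∑ nu ∈ down lam, ∑ rho ∈ up nu, (partSum F rho - partSum F nu) * G rho +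
      (∑ Lam ∈ up lam, (partSum F Lam - partSum F lam) -
        ∑ nu ∈ down lam, (partSum F lam - partSum F nu)) * G lam := by
  classical
  have hleft : ∀ Lam ∈ up lam, (partSum F Lam - partSum F lam) * ∑ rho ∈ down Lam, G rho =
      (partSum F Lam - partSum F lam) * G lam +
        ∑ rho ∈ (down Lam).erase lam, (partSum F Lam - partSum F lam) * G rho := by
    intro Lam h
    rw [← Finset.add_sum_erase _ _ (mem_down.mpr (mem_up.mp h)), mul_add, Finset.mul_sum]
  have hright : ∀ nu ∈ down lam, ∑ rho ∈ up nu, (partSum F rho - partSum F nu) * G rho =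
      (partSum F lam - partSum F nu) * G lam +
        ∑ rho ∈ (up nu).erase lam, (partSum F rho - partSum F nu) * G rho := by
    intro nu h
    rw [← Finset.add_sum_erase _ _ (mem_up.mpr (mem_down.mp h))]
  -- Off the diagonal, `Lam` is the union and `nu` the intersection of `lam` and `rho`, so each
  -- determines the other; the weights agree by modularity, `partSum_sup_add_inf`.
  have hoff : ∑ Lam ∈ up lam, ∑ rho ∈ (down Lam).erase lam,
        (partSum F Lam - partSum F lam) * G rho =
      ∑ nu ∈ down lam, ∑ rho ∈ (up nu).erase lam, (partSum F rho - partSum F nu) * G rho := by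
    rw [Finset.sum_sigma', Finset.sum_sigma']
    refine Finset.sum_bij' (fun x _ => ⟨inf lam x.2, x.2⟩) (fun x _ => ⟨sup lam x.2, x.2⟩)
      ?_ ?_ ?_ ?_ ?_
    all_goals
      rintro ⟨x, rho⟩ hx
      simp only [Finset.mem_sigma, Finset.mem_erase, mem_up, mem_down] at hx ⊢
      obtain ⟨h1, hne, h2⟩ := hx
    · have := of_common_upper h1 h2 hne
      exact ⟨this.2.1, hne, this.2.2⟩
    · have := of_common_lower h1 h2 hne
      exact ⟨this.2.1, hne, this.2.2⟩
    · rw [← (of_common_upper h1 h2 hne).1]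
    · rw [← (of_common_lower h1 h2 hne).1]
    · rw [(of_common_upper h1 h2 hne).1]
      have := partSum_sup_add_inf hF lam rho
      congr 1
      linarith
  rw [Finset.sum_congr rfl hleft, Finset.sum_congr rfl hright, Finset.sum_add_distrib,
    Finset.sum_add_distrib, hoff, ← Finset.sum_mul, ← Finset.sum_mul]
  ring

theorem StepAt.right_unique {i : ℕ} {lam Lam Lam' : StrictPartition} (h : StepAt i lam Lam)
    (h' : StepAt i lam Lam') : Lam = Lam' :=
  ext_row fun k => by rw [h k, h' k]

theorem StepAt.left_unique {i : ℕ} {lam lam' Lam : StrictPartition} (h : StepAt i lam Lam)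
    (h' : StepAt i lam' Lam) : lam = lam' :=
  ext_row fun k => by have := h k; have := h' k; omega

theorem StepAt.index_unique {i j : ℕ} {lam Lam : StrictPartition} (h : StepAt i lam Lam)
    (h' : StepAt j lam Lam) : i = j := by
  have h1 := h i
  have h2 := h' i
  split_ifs at h1 h2 <;> first | assumption | omega

theorem exists_stepAt_up {lam : StrictPartition} {i : ℕ}
    (h : ∀ j, i = j + 1 → lam.row i + 1 ≠ lam.row j) (hi : i ≤ lam.length) :
    ∃ Lam, StepAt i lam Lam := by
  refine exists_row_eq _ fun j => ?_
  have h1 := lam.row_succ_le j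
  by_cases hj : j + 1 = i
  · have h2 := h j hj.symm
    -- Here `hi` is needed: if rows `j` and `i` were both empty, `h` would hold although no box
    -- fits.
    have h3 : 0 < lam.row j := row_pos_iff.mpr (by omega)
    subst hj
    rw [if_pos rfl, if_neg (by omega)]
    omega
  · rw [if_neg hj]
    omega

/-- Length 1 is a separate case because a row may vanish: empty rows need not decrease strictly. -/
theorem exists_stepAt_down {lam : StrictPartition} {i : ℕ} (hi : i < lam.length)
    (h : lam.row i = 1 ∨ lam.row (i + 1) + 1 ≠ lam.row i) :
    ∃ nu, StepAt i nu lam := by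
  have hpos := row_pos_iff.mpr hi
  obtain ⟨nu, hnu⟩ := exists_row_eq (fun j => lam.row j - if j = i then 1 else 0) fun j => by
    have h1 := lam.row_succ_le j
    by_cases hj : j = i
    · subst hj
      rw [if_pos rfl, if_neg (by omega)]
      omega
    · rw [if_neg hj]
      omega
  refine ⟨nu, fun j => ?_⟩
  rw [hnu]
  split_ifs with hj
  · subst hj
    omega
  · rfl

/-- Row 0 can always grow, and row `i + 1` unless it would reach the length of row `i`. The range
includes the first empty row. -/
theorem sum_up_partSum {F : ℕ → ℚ} (hF : F 0 = 0) (lam : StrictPartition) :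
    ∑ Lam ∈ up lam, (partSum F Lam - partSum F lam) =
      F (lam.row 0 + 1) - F (lam.row 0) + ∑ i ∈ Finset.range lam.length,
        if lam.row (i + 1) + 1 ≠ lam.row i then
          F (lam.row (i + 1) + 1) - F (lam.row (i + 1)) else 0 := by
  classical
  have key : ∑ Lam ∈ up lam, (partSum F Lam - partSum F lam) =
      ∑ i ∈ Finset.range (lam.length + 1),
        if ∀ j, i = j + 1 → lam.row i + 1 ≠ lam.row j then
          F (lam.row i + 1) - F (lam.row i) else 0 := by
    rw [← Finset.sum_filter]
    symm
    have hex : ∀ i ∈ (Finset.range (lam.length + 1)).filter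
        (fun i => ∀ j, i = j + 1 → lam.row i + 1 ≠ lam.row j), ∃ Lam, StepAt i lam Lam := by
      intro i hi
      rw [Finset.mem_filter, Finset.mem_range] at hi
      exact exists_stepAt_up hi.2 (by omega)
    refine Finset.sum_bij (fun i hi => (hex i hi).choose) ?_ ?_ ?_ ?_
    · intro i hi
      exact mem_up.mpr (addsOneBox_iff.mpr ⟨i, (hex i hi).choose_spec⟩)
    · intro i hi j hj hij
      have h1 := (hex i hi).choose_spec
      rw [hij] at h1
      exact h1.index_unique (hex j hj).choose_spec
    · intro Lam hLam
      obtain ⟨i, hi⟩ := addsOneBox_iff.mp (mem_up.mp hLam)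
      have hmem : i ∈ (Finset.range (lam.length + 1)).filter
          (fun i => ∀ j, i = j + 1 → lam.row i + 1 ≠ lam.row j) := by
        have hdec : ∀ j, i = j + 1 → lam.row i + 1 < lam.row j := by
          rintro j rfl
          have h1 := hi (j + 1)
          have h2 := hi j
          have h3 := Lam.row_succ_le j
          rw [if_pos rfl] at h1
          rw [if_neg (by omega)] at h2
          omega
        rw [Finset.mem_filter, Finset.mem_range]
        refine ⟨?_, fun j hj => (hdec j hj).ne⟩
        obtain _ | j := i
        · omega
        · have := hdec j rfl
          have := (row_pos_iff (lam := lam) (i := j)).mp (by omega)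
          omega
      exact ⟨i, hmem, (hex i hmem).choose_spec.right_unique hi⟩
    · intro i hi
      exact (partSum_stepAt hF (hex i hi).choose_spec).symm
  rw [key, Finset.sum_range_succ', add_comm]
  congr 1
  · rw [if_pos (by intro j hj; omega)]
  · refine Finset.sum_congr rfl fun i _ => ?_
    simp

theorem sum_down_partSum {F : ℕ → ℚ} (hF : F 0 = 0) (lam : StrictPartition) :
    ∑ nu ∈ down lam, (partSum F lam - partSum F nu) =
      ∑ i ∈ Finset.range lam.length,
        if lam.row i = 1 ∨ lam.row (i + 1) + 1 ≠ lam.row i then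
          F (lam.row i) - F (lam.row i - 1) else 0 := by
  classical
  rw [← Finset.sum_filter]
  symm
  have hex : ∀ i ∈ (Finset.range lam.length).filter
      (fun i => lam.row i = 1 ∨ lam.row (i + 1) + 1 ≠ lam.row i), ∃ nu, StepAt i nu lam := by
    intro i hi
    rw [Finset.mem_filter, Finset.mem_range] at hi
    exact exists_stepAt_down hi.1 hi.2
  refine Finset.sum_bij (fun i hi => (hex i hi).choose) ?_ ?_ ?_ ?_
  · intro i hi
    exact mem_down.mpr (addsOneBox_iff.mpr ⟨i, (hex i hi).choose_spec⟩)
  · intro i hi j hj hij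
    have h1 := (hex i hi).choose_spec
    rw [hij] at h1
    exact h1.index_unique (hex j hj).choose_spec
  · intro nu hnu
    obtain ⟨i, hi⟩ := addsOneBox_iff.mp (mem_down.mp hnu)
    have hmem : i ∈ (Finset.range lam.length).filter
        (fun i => lam.row i = 1 ∨ lam.row (i + 1) + 1 ≠ lam.row i) := by
      have h1 := hi i
      have h2 := hi (i + 1)
      have h3 := nu.row_succ_le i
      rw [if_pos rfl] at h1
      rw [if_neg (by omega)] at h2
      rw [Finset.mem_filter, Finset.mem_range, ← row_pos_iff]
      omega
    exact ⟨i, hmem, (hex i hmem).choose_spec.left_unique hi⟩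
  · intro i hi
    have h := (hex i hi).choose_spec
    have h1 := h i
    rw [if_pos rfl] at h1
    rw [partSum_stepAt hF h, h1, Nat.add_sub_cancel]

/-- The diagonal part of the commutator, telescoped over the rows. -/
theorem sum_up_sub_sum_down {F : ℕ → ℚ} (hF : F 0 = 0) (lam : StrictPartition) :
    ∑ Lam ∈ up lam, (partSum F Lam - partSum F lam) -
        ∑ nu ∈ down lam, (partSum F lam - partSum F nu) =
      F 1 + partSum (fun a => F (a + 1) - 2 * F a + F (a - 1) - if a = 1 then F 1 else 0) lam := by
  -- The boundary term at the first empty row is the source of the constant `F 1`.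
  have tele := Finset.sum_range_sub (fun i => F (lam.row i + 1) - F (lam.row i)) lam.length
  simp only [row_eq_zero le_rfl, hF, zero_add, sub_zero] at tele
  have hterm : ∀ i ∈ Finset.range lam.length,
      ((if lam.row (i + 1) + 1 ≠ lam.row i then
          F (lam.row (i + 1) + 1) - F (lam.row (i + 1)) else 0) -
        if lam.row i = 1 ∨ lam.row (i + 1) + 1 ≠ lam.row i then
          F (lam.row i) - F (lam.row i - 1) else 0) =
      (F (lam.row (i + 1) + 1) - F (lam.row (i + 1)) - (F (lam.row i + 1) - F (lam.row i))) +
        (F (lam.row i + 1) - 2 * F (lam.row i) + F (lam.row i - 1) -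
          if lam.row i = 1 then F 1 else 0) := by
    intro i hi
    have hpos := row_pos_iff.mpr (Finset.mem_range.mp hi)
    have hdec := lam.row_succ_le i
    generalize lam.row i = a at *
    generalize lam.row (i + 1) = b at *
    by_cases h : b + 1 = a
    · subst h
      -- A row of length 1 can lose its box although the next row cannot gain one; this asymmetry is
      -- the correction at `a = 1`.
      by_cases hb : b = 0
      · subst hb
        simp [hF]
        ring
      · simp [hb]
        ring
    · have ha : a ≠ 1 := by omega
      simp only [ne_eq, h, not_false_eq_true, if_true, or_true, ha, if_false]
      ring
  rw [sum_up_partSum hF, sum_down_partSum hF, add_sub_assoc, ← Finset.sum_sub_distrib,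
    Finset.sum_congr rfl hterm, Finset.sum_add_distrib, tele]
  unfold partSum
  ring


/-! ### Counting chains by their last step -/

/-- The chains of `k` box additions from `mu` to `lam`. -/
def chains (k : ℕ) (mu lam : StrictPartition) : Set (Fin (k + 1) → StrictPartition) :=
  {T | T 0 = mu ∧ T (Fin.last _) = lam ∧ ∀ i : Fin k, AddsOneBox (T i.castSucc) (T i.succ)}

theorem chains_zero (mu lam : StrictPartition) :
    chains 0 mu lam = {T | T 0 = mu ∧ mu = lam} := by
  ext T
  simp only [chains, Set.mem_ofPred_eq, IsEmpty.forall_iff, and_true]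
  constructor
  · rintro ⟨h1, h2⟩
    exact ⟨h1, h1.symm.trans h2⟩
  · rintro ⟨h1, h2⟩
    exact ⟨h1, h1.trans h2⟩

theorem chains_zero_self (mu : StrictPartition) : (chains 0 mu mu).ncard = 1 := by
  rw [Set.ncard_eq_one]
  refine ⟨fun _ => mu, ?_⟩
  rw [chains_zero]
  ext T
  simp only [and_true, Set.mem_ofPred_eq, Set.mem_singleton_iff]
  constructor
  · intro h
    funext i
    rw [Fin.fin_one_eq_zero i, h]
  · rintro rfl
    rfl

theorem chains_succ (k : ℕ) (mu lam : StrictPartition) :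
    chains (k + 1) mu lam =
      ⋃ nu ∈ down lam, (fun T => (Fin.snoc T lam : Fin (k + 2) → StrictPartition)) ''
        chains k mu nu := by
  ext T
  simp only [Set.mem_iUnion, Set.mem_image, exists_prop]
  constructor
  · rintro ⟨h0, hl, hs⟩
    refine ⟨T (Fin.last k).castSucc, mem_down.mpr ?_, Fin.init T, ⟨h0, rfl, fun i => ?_⟩, ?_⟩
    · rw [← hl]
      exact hs (Fin.last k)
    · exact hs i.castSucc
    · rw [← hl]
      exact Fin.snoc_init_self T
  · rintro ⟨nu, hnu, T, ⟨h0, hl, hs⟩, rfl⟩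
    refine ⟨?_, Fin.snoc_last _ _, fun i => ?_⟩
    · rw [← h0]
      exact Fin.snoc_castSucc (α := fun _ => StrictPartition) _ _ 0
    · refine Fin.lastCases ?_ (fun i => ?_) i
      · rw [Fin.succ_last, Fin.snoc_last, Fin.snoc_castSucc, hl]
        exact mem_down.mp hnu
      · rw [Fin.succ_castSucc, Fin.snoc_castSucc, Fin.snoc_castSucc]
        exact hs i

theorem chains_finite (k : ℕ) (mu lam : StrictPartition) : (chains k mu lam).Finite := by
  induction k generalizing lam with
  | zero =>
    rw [chains_zero]
    refine (Set.finite_singleton fun _ => mu).subset ?_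
    rintro T ⟨h, -⟩
    exact funext fun i => by rw [Fin.fin_one_eq_zero i, h]
  | succ k ih =>
    rw [chains_succ]
    exact (down lam).finite_toSet.biUnion fun nu _ => (ih nu).image _

theorem ncard_chains_succ (k : ℕ) (mu lam : StrictPartition) :
    (chains (k + 1) mu lam).ncard = ∑ nu ∈ down lam, (chains k mu nu).ncard := by
  have hinj : Function.Injective
      fun T : Fin (k + 1) → StrictPartition => (Fin.snoc T lam : Fin (k + 2) → StrictPartition) :=
    fun T T' h => (Fin.snoc_injective2 h).1
  rw [chains_succ]
  have := (down lam).finite_toSet.ncard_biUnion (s := fun nu => (fun T => (Fin.snoc T lam :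
    Fin (k + 2) → StrictPartition)) '' chains k mu nu)
    (fun nu _ => (chains_finite k mu nu).image _) fun a _ b _ hab => by
      rw [Function.onFun, Set.disjoint_left]
      rintro _ ⟨T, hT, rfl⟩ ⟨T', hT', h⟩
      have := hinj h
      subst this
      exact hab (hT.2.1.symm.trans hT'.2.1)
  rw [finsum_mem_coe_finset] at this
  simp only [Finset.mem_coe] at this
  rw [this]
  exact Finset.sum_congr rfl fun nu _ => Set.ncard_image_of_injective _ hinj

/-- This makes the containment test in `skewG` redundant: where it fails, there are no chains to
count. -/
theorem diagram_subset_of_chains_nonempty {k : ℕ} {mu lam : StrictPartition}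
    (h : (chains k mu lam).Nonempty) : mu.diagram ⊆ lam.diagram := by
  induction k generalizing lam with
  | zero =>
    rw [chains_zero] at h
    obtain ⟨_, _, rfl⟩ := h
    exact subset_rfl
  | succ k ih =>
    rw [chains_succ] at h
    obtain ⟨T, hT⟩ := h
    simp only [Set.mem_iUnion, Set.mem_image, exists_prop] at hT
    obtain ⟨nu, hnu, T, hT, -⟩ := hT
    exact (ih ⟨T, hT⟩).trans (mem_down.mp hnu).subset

theorem skewG_eq_ncard_chains {k : ℕ} {mu lam : StrictPartition} (h : lam.size = k + mu.size) :
    skewG lam mu = (chains k mu lam).ncard := by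
  obtain rfl : k = lam.size - mu.size := by omega
  unfold skewG
  split_ifs with hs
  · rfl
  · rw [Set.not_nonempty_iff_eq_empty.mp fun hne => hs (diagram_subset_of_chains_nonempty hne),
      Set.ncard_empty]

theorem skewG_eq_sum_down {mu lam : StrictPartition} (h : mu.size < lam.size) :
    skewG lam mu = ∑ nu ∈ down lam, skewG nu mu := by
  obtain ⟨k, hk⟩ : ∃ k, lam.size = (k + 1) + mu.size := ⟨lam.size - mu.size - 1, by omega⟩
  rw [skewG_eq_ncard_chains hk, ncard_chains_succ]
  refine Finset.sum_congr rfl fun nu hnu => (skewG_eq_ncard_chains ?_).symm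
  have := (mem_down.mp hnu).size_eq
  omega

theorem skewG_self (mu : StrictPartition) : skewG mu mu = 1 := by
  rw [skewG_eq_ncard_chains (k := 0) (by omega), chains_zero_self]

theorem skewG_eq_zero_of_size_eq {mu lam : StrictPartition} (h : lam.size = mu.size)
    (hne : lam ≠ mu) : skewG lam mu = 0 := by
  rw [skewG_eq_ncard_chains (k := 0) (by omega), chains_zero]
  simp [hne.symm]

theorem size_empty : empty.size = 0 := rfl

theorem g_eq_sum_down {lam : StrictPartition} (h : 0 < lam.size) :
    g lam = ∑ nu ∈ down lam, g nu :=
  skewG_eq_sum_down (by rwa [size_empty])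

theorem row_eq_zero_of_size_eq_zero {lam : StrictPartition} (h : lam.size = 0) (i : ℕ) :
    lam.row i = 0 := by
  refine row_eq_zero ?_
  by_contra hl
  have hlt : 0 < lam.parts.length := by
    unfold length at hl
    omega
  have h1 := lam.pos _ (List.getElem_mem hlt)
  have h2 := List.single_le_sum (by simp) _ (List.getElem_mem hlt)
  unfold size at h
  omega

theorem down_nonempty {lam : StrictPartition} (h : 0 < lam.size) : (down lam).Nonempty := by
  have hl : 0 < lam.length := by
    by_contra hl
    have : lam.parts = [] := List.length_eq_zero_iff.mp (Nat.eq_zero_of_not_pos hl)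
    simp [size, this] at h
  obtain ⟨nu, hnu⟩ := exists_stepAt_down (lam := lam) (i := lam.length - 1) (by omega) (by
    rw [Nat.sub_add_cancel hl, row_eq_zero le_rfl]
    omega)
  exact ⟨nu, mem_down.mpr (addsOneBox_iff.mpr ⟨_, hnu⟩)⟩

theorem g_pos (lam : StrictPartition) : 0 < g lam := by
  induction hm : lam.size generalizing lam with
  | zero =>
    have : lam = empty := ext_row fun i => by
      rw [row_eq_zero_of_size_eq_zero hm, row_eq_zero_of_size_eq_zero size_empty]
    rw [this, g, skewG_self]
    exact one_pos
  | succ m ih =>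
    rw [g_eq_sum_down (by omega)]
    refine Finset.sum_pos (fun nu hnu => ih nu ?_) (down_nonempty (by omega))
    have := (mem_down.mp hnu).size_eq
    omega

/-! ### The up operator applied to g -/

/-- The up operator of weight `partSum F Lam - partSum F lam`, applied to `g`. -/
noncomputable def upG (F : ℕ → ℚ) (lam : StrictPartition) : ℚ :=
  ∑ Lam ∈ up lam, (partSum F Lam - partSum F lam) * g Lam

theorem upG_eq {F : ℕ → ℚ} (hF : F 0 = 0) (lam : StrictPartition) :
    upG F lam = ∑ nu ∈ down lam, upG F nu +
      (F 1 + partSum (fun a => F (a + 1) - 2 * F a + F (a - 1) - if a = 1 then F 1 else 0) lam) *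
        g lam := by
  unfold upG
  rw [← sum_up_sub_sum_down hF, ← sum_up_sum_down hF (fun nu => (g nu : ℚ))]
  refine Finset.sum_congr rfl fun Lam hLam => ?_
  have := (mem_up.mp hLam).size_eq
  rw [g_eq_sum_down (by omega : 0 < Lam.size), Nat.cast_sum]

/-- If the diagonal part of the commutator is the increment of a polynomial in the size, then `g`
is an eigenvector of the up operator. -/
theorem upG_eq_of_diagonal {F : ℕ → ℚ} (hF : F 0 = 0) (q : ℚ → ℚ) (hq : q (-1) = 0)
    (hd : ∀ lam : StrictPartition, F 1 + partSum
      (fun a => F (a + 1) - 2 * F a + F (a - 1) - if a = 1 then F 1 else 0) lam =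
        q lam.size - q (lam.size - 1)) (lam : StrictPartition) :
    upG F lam = q lam.size * g lam := by
  induction hm : lam.size generalizing lam with
  | zero =>
    -- Nothing lies below the empty partition, so only `q 0 - q (-1)` remains, and `hq` makes it `q
    -- 0`.
    have : down lam = ∅ := Finset.eq_empty_of_forall_notMem fun nu hnu => by
      have := (mem_down.mp hnu).size_eq
      omega
    rw [upG_eq hF, this, hd, hm]
    simp [hq]
  | succ m ih =>
    have h1 : ∑ nu ∈ down lam, upG F nu = q m * g lam := by
      rw [g_eq_sum_down (by omega), Nat.cast_sum, Finset.mul_sum]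
      refine Finset.sum_congr rfl fun nu hnu => ih nu ?_
      have := (mem_down.mp hnu).size_eq
      omega
    rw [upG_eq hF, h1, hd, hm]
    push_cast
    rw [add_sub_cancel_right]
    ring

/-- Its increments are the edge weights: `1` for a diagonal box and `2` otherwise. -/
def edgeWeight (a : ℕ) : ℚ := if a = 0 then 0 else 2 * a - 1

/-- Its increments are the edge weights times the increments of `hatP1`. -/
def contentWeight (a : ℕ) : ℚ := ((a : ℚ) - 1) * a * (a + 1) / 3

theorem upG_edgeWeight (lam : StrictPartition) :
    upG edgeWeight lam = (lam.size + 1) * g lam := by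
  refine upG_eq_of_diagonal (by simp [edgeWeight]) (fun x => x + 1) (by norm_num)
    (fun lam => ?_) lam
  have : partSum (fun a => edgeWeight (a + 1) - 2 * edgeWeight a + edgeWeight (a - 1) -
      if a = 1 then edgeWeight 1 else 0) lam = 0 := by
    refine Finset.sum_eq_zero fun i hi => ?_
    have hpos := row_pos_iff.mpr (Finset.mem_range.mp hi)
    generalize lam.row i = a at hpos
    -- `edgeWeight` is affine from 1 on; at 1 its second difference is 1, cancelled by the
    -- correction `F 1`.
    obtain _ | _ | a := a
    · omega
    · norm_num [edgeWeight]
    · simp [edgeWeight]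
      ring
  rw [this]
  norm_num [edgeWeight]

/-- The second difference of `contentWeight` at `a` is `2a` and its value at 1 is 0, so the diagonal
entry is 2|λ|, the increment of x(x+1). -/
theorem upG_contentWeight (lam : StrictPartition) :
    upG contentWeight lam = lam.size * (lam.size + 1) * g lam := by
  refine upG_eq_of_diagonal (by simp [contentWeight]) (fun x => x * (x + 1)) (by norm_num)
    (fun lam => ?_) lam
  have : partSum (fun a => contentWeight (a + 1) - 2 * contentWeight a + contentWeight (a - 1) -
      if a = 1 then contentWeight 1 else 0) lam = 2 * lam.size := by
    rw [← partSum_cast, partSum, partSum, Finset.mul_sum]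
    refine Finset.sum_congr rfl fun i hi => ?_
    have hpos := row_pos_iff.mpr (Finset.mem_range.mp hi)
    generalize lam.row i = a at hpos
    obtain _ | a := a
    · omega
    · simp [contentWeight]
      ring
  rw [this]
  norm_num [contentWeight]
  ring

theorem two_zpow_eq_partSum_edgeWeight {lam Lam : StrictPartition} (h : AddsOneBox lam Lam) :
    (2 : ℚ) ^ (1 - (Lam.length : ℤ) + lam.length) =
      partSum edgeWeight Lam - partSum edgeWeight lam := by
  obtain ⟨i, h⟩ := addsOneBox_iff.mp h
  rw [partSum_stepAt (by simp [edgeWeight]) h, length_stepAt h]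
  by_cases h0 : lam.row i = 0
  · simp [h0, edgeWeight]
    norm_num
  · simp [h0, edgeWeight]
    ring

/-- A box added to a row of length `a` has content `a`. For `a = 0` it contributes nothing, so the
factor 2 can be used throughout and one cubic serves for all rows. -/
theorem two_zpow_mul_hatP1_sub {lam Lam : StrictPartition} (h : AddsOneBox lam Lam) :
    (2 : ℚ) ^ (1 - (Lam.length : ℤ) + lam.length) * (hatP1 Lam - hatP1 lam) =
      partSum contentWeight Lam - partSum contentWeight lam := by
  rw [two_zpow_eq_partSum_edgeWeight h, hatP1_eq_partSum, hatP1_eq_partSum]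
  obtain ⟨i, h⟩ := addsOneBox_iff.mp h
  rw [partSum_stepAt (F := edgeWeight) (by simp [edgeWeight]) h,
    partSum_stepAt (F := contentWeight) (by simp [contentWeight]) h,
    partSum_stepAt (by simp) h]
  by_cases h0 : lam.row i = 0
  · simp [h0, contentWeight]
  · simp [h0, edgeWeight, contentWeight]
    ring

/-! ### Recursion for the averages -/

/-- The average without its normalization. -/
noncomputable def weightedSum (mu : StrictPartition) (n : ℕ) (φ : StrictPartition → ℚ) : ℚ :=
  ∑ lam ∈ ofSize (n + mu.size),
    (2 : ℚ) ^ ((n : ℤ) - (lam.length : ℤ) + (mu.length : ℤ)) * g lam * skewG lam mu * φ lam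

theorem average_eq_weightedSum (mu : StrictPartition) (n : ℕ) (φ : StrictPartition → ℚ) :
    average mu n φ =
      (mu.size.factorial : ℚ) / ((n + mu.size).factorial * g mu) * weightedSum mu n φ := by
  rw [average, weightedSum, Finset.mul_sum]
  refine Finset.sum_congr rfl fun lam _ => ?_
  rw [prob]
  ring

theorem weightedSum_zero (mu : StrictPartition) (φ : StrictPartition → ℚ) :
    weightedSum mu 0 φ = g mu * φ mu := by
  rw [weightedSum, Finset.sum_eq_single mu]
  · simp [skewG_self]
  · intro lam hlam hne
    rw [mem_ofSize, zero_add] at hlam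
    simp [skewG_eq_zero_of_size_eq hlam hne]
  · intro h
    exact absurd (mem_ofSize.mpr (by omega)) h

/-- Chains are split at their last box, and the power of 2 splits with them. -/
theorem weightedSum_succ (mu : StrictPartition) (n : ℕ) (φ : StrictPartition → ℚ) :
    weightedSum mu (n + 1) φ = ∑ lam ∈ ofSize (n + mu.size),
      (2 : ℚ) ^ ((n : ℤ) - (lam.length : ℤ) + (mu.length : ℤ)) * skewG lam mu *
        ∑ Lam ∈ up lam, (2 : ℚ) ^ (1 - (Lam.length : ℤ) + lam.length) * g Lam * φ Lam := by
  simp only [Finset.mul_sum]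
  rw [Finset.sum_sigma', weightedSum]
  have h : ∀ Lam ∈ ofSize (n + 1 + mu.size),
      (2 : ℚ) ^ (((n + 1 : ℕ) : ℤ) - (Lam.length : ℤ) + (mu.length : ℤ)) * g Lam *
        skewG Lam mu * φ Lam = ∑ lam ∈ down Lam,
      (2 : ℚ) ^ ((n : ℤ) - (lam.length : ℤ) + (mu.length : ℤ)) * skewG lam mu *
        ((2 : ℚ) ^ (1 - (Lam.length : ℤ) + lam.length) * g Lam * φ Lam) := by
    intro Lam hLam
    rw [mem_ofSize] at hLam
    rw [skewG_eq_sum_down (by omega), Nat.cast_sum, Finset.mul_sum, Finset.sum_mul]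
    refine Finset.sum_congr rfl fun lam _ => ?_
    have : ((n + 1 : ℕ) : ℤ) - (Lam.length : ℤ) + (mu.length : ℤ) =
        ((n : ℤ) - (lam.length : ℤ) + (mu.length : ℤ)) +
          (1 - (Lam.length : ℤ) + lam.length) := by
      push_cast
      ring
    rw [this, zpow_add₀ two_ne_zero]
    ring
  rw [Finset.sum_congr rfl h, Finset.sum_sigma']
  refine Finset.sum_bij' (fun x _ => ⟨x.2, x.1⟩) (fun x _ => ⟨x.2, x.1⟩) ?_ ?_ ?_ ?_ ?_
  · rintro ⟨Lam, lam⟩ hx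
    simp only [Finset.mem_sigma, mem_ofSize, mem_down, mem_up] at hx ⊢
    have := hx.2.size_eq
    exact ⟨by omega, hx.2⟩
  · rintro ⟨lam, Lam⟩ hx
    simp only [Finset.mem_sigma, mem_ofSize, mem_down, mem_up] at hx ⊢
    have := hx.2.size_eq
    exact ⟨by omega, hx.2⟩
  all_goals
    intros
    rfl

theorem sum_up_one (lam : StrictPartition) :
    ∑ Lam ∈ up lam, (2 : ℚ) ^ (1 - (Lam.length : ℤ) + lam.length) * g Lam =
      (lam.size + 1) * g lam := by
  rw [← upG_edgeWeight, upG]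
  refine Finset.sum_congr rfl fun Lam h => ?_
  rw [two_zpow_eq_partSum_edgeWeight (mem_up.mp h)]

/-- The increment of `hatP1` over the step is handled by `contentWeight`, the remaining constant
`hatP1 lam - c` by `edgeWeight`. -/
theorem sum_up_hatP1_sub (lam : StrictPartition) (c : ℚ) :
    ∑ Lam ∈ up lam, (2 : ℚ) ^ (1 - (Lam.length : ℤ) + lam.length) * g Lam * (hatP1 Lam - c) =
      (lam.size + 1) * g lam * (hatP1 lam - c + lam.size) := by
  have h : ∀ Lam ∈ up lam,
      (2 : ℚ) ^ (1 - (Lam.length : ℤ) + lam.length) * g Lam * (hatP1 Lam - c) =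
        (partSum contentWeight Lam - partSum contentWeight lam) * g Lam +
        (2 : ℚ) ^ (1 - (Lam.length : ℤ) + lam.length) * g Lam * (hatP1 lam - c) := by
    intro Lam h
    rw [← two_zpow_mul_hatP1_sub (mem_up.mp h)]
    ring
  rw [Finset.sum_congr rfl h, Finset.sum_add_distrib, ← Finset.sum_mul, sum_up_one]
  have := upG_contentWeight lam
  rw [upG] at this
  rw [this]
  ring

theorem weightedSum_succ_one (mu : StrictPartition) (n : ℕ) :
    weightedSum mu (n + 1) (fun _ => 1) =
      (n + mu.size + 1) * weightedSum mu n (fun _ => 1) := by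
  rw [weightedSum_succ, weightedSum, Finset.mul_sum]
  refine Finset.sum_congr rfl fun lam hlam => ?_
  simp only [mul_one]
  rw [sum_up_one, mem_ofSize.mp hlam]
  push_cast
  ring

theorem weightedSum_succ_hatP1_sub (mu : StrictPartition) (n : ℕ) (c : ℚ) :
    weightedSum mu (n + 1) (fun lam => hatP1 lam - c) =
      (n + mu.size + 1) * (weightedSum mu n (fun lam => hatP1 lam - c) +
        (n + mu.size) * weightedSum mu n (fun _ => 1)) := by
  rw [weightedSum_succ, weightedSum, weightedSum, Finset.mul_sum, ← Finset.sum_add_distrib,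
    Finset.mul_sum]
  refine Finset.sum_congr rfl fun lam hlam => ?_
  rw [sum_up_hatP1_sub, mem_ofSize.mp hlam]
  push_cast
  ring

theorem average_zero (mu : StrictPartition) (φ : StrictPartition → ℚ) :
    average mu 0 φ = φ mu := by
  have h1 : (g mu : ℚ) ≠ 0 := by exact_mod_cast (g_pos mu).ne'
  have h2 : (mu.size.factorial : ℚ) ≠ 0 := by exact_mod_cast mu.size.factorial_ne_zero
  rw [average_eq_weightedSum, weightedSum_zero, zero_add]
  field_simp

theorem factorial_succ_add_cast (n m : ℕ) :
    ((n + 1 + m).factorial : ℚ) = (n + m + 1) * (n + m).factorial := by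
  rw [show n + 1 + m = n + m + 1 by ring, Nat.factorial_succ]
  push_cast
  ring

theorem average_one (mu : StrictPartition) (n : ℕ) : average mu n (fun _ => 1) = 1 := by
  induction n with
  | zero => exact average_zero mu _
  | succ n ih =>
    have h : (n : ℚ) + mu.size + 1 ≠ 0 := by positivity
    refine Eq.trans ?_ ih
    rw [average_eq_weightedSum, average_eq_weightedSum, weightedSum_succ_one,
      factorial_succ_add_cast]
    field_simp

/-- Every partition reached after `n` steps has size `n + |mu|`, so the mean increment is this
constant times the total mass, which is 1. -/
theorem average_succ_hatP1_sub (mu : StrictPartition) (n : ℕ) (c : ℚ) :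
    average mu (n + 1) (fun lam => hatP1 lam - c) =
      average mu n (fun lam => hatP1 lam - c) + (n + mu.size) := by
  have h : (n : ℚ) + mu.size + 1 ≠ 0 := by positivity
  have h1 := average_one mu n
  rw [average_eq_weightedSum] at h1
  rw [average_eq_weightedSum, average_eq_weightedSum, weightedSum_succ_hatP1_sub,
    factorial_succ_add_cast]
  calc _ = (mu.size.factorial : ℚ) / ((n + mu.size).factorial * g mu) *
        weightedSum mu n (fun lam => hatP1 lam - c) + (n + mu.size) *
        ((mu.size.factorial : ℚ) / ((n + mu.size).factorial * g mu) *
          weightedSum mu n (fun _ => 1)) := by field_simp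
    _ = _ := by rw [h1, mul_one]

end StrictPartition

theorem mainTheorem9 (mu : StrictPartition) (n : ℕ) :
    StrictPartition.average mu n
        (fun lam => StrictPartition.hatP1 lam - StrictPartition.hatP1 mu) =
      (n : ℚ) * ((n : ℚ) - 1) / 2 + (n : ℚ) * (mu.size : ℚ) := by
  induction n with
  | zero =>
    rw [StrictPartition.average_zero]
    simp
  | succ n ih =>
    rw [StrictPartition.average_succ_hatP1_sub, ih]
    push_cast
    ring
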